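/- Let $(X,\delta_X)$ and $(Y,\delta_Y)$ be represented spaces, that is, sets with surjective partial maps $\delta_X:\subseteq\mathbb N^{\mathbb N}\to X$ and $\delta_Y:\subseteq\mathbb N^{\mathbb N}\to Y$, and let $f:\subseteq X\rightrightarrows Y$ be a partial multi-valued function. Then the following are equivalent: 1. $f\le_W C_{\mathbb N}$; 2. $f\le_W \lim_\Delta$; 3. $f$ is computable with finitely many mind changes. Moreover, $\lim_\Delta\equiv_W C_{\mathbb N}$. Here the following notions are used. - A partial function $F:\subseteq\mathbb N^{\mathbb N}\to\mathbb N^{\mathbb N}$ is a realizer of $f$, written $F\vdash f$, if $\delta_Y(F(p))$ is defined and lies in $f(\delta_X(p))$ for all $p\in\mathrm{dom}(\delta_X)$ with $f(\delta_X(p))\neq\emptyset$. - For multi-valued functions $f,g$ on represented spaces, $f\le_W g$ means that there are computable partial functions $K,H:\subseteq\mathbb N^{\mathbb N}\to\mathbb N^{\mathbb N}$ (computed by Type-2 Turing machines with one-way output) such that $K\circ\langle \mathrm{id},G\circ H\rangle\vdash f$ for every $G\vdash g$. Further, $f\equiv_W g$ means $f\le_W g$ and $g\le_W f$. Here $\langle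 p,q\rangle(2n)=p(n)$ and $\langle p,q\rangle(2n+1)=q(n)$. - $C_{\mathbb N}:\subseteq\mathcal A_-(\mathbb N)\rightrightarrows\mathbb N$, $A\mapsto A$, is closed choice on $\mathbb N$; its domain is the set of non-empty subsets $A\subseteq\mathbb N$. Here $p$ is a name of $A\in\mathcal A_-(\mathbb N)$ if $A=\{n\in\mathbb N: n+1\notin\mathrm{range}(p)\}$, and $p$ is a name of the number $p(0)\in\mathbb N$. - $\lim_\Delta:\subseteq\mathbb N^{\mathbb N}\to\mathbb N^{\mathbb N}$, $\langle p_0,p_1,p_2,\dots\rangle\mapsto\lim_{i\to\infty}p_i$, is the limit with respect to the discrete topology on $\mathbb N^{\mathbb N}$; it is defined exactly if $(p_i)_i$ is eventually constant. Here $\langle p_0,p_1,\dots\rangle(\langle i,j\rangle)=p_i(j)$ for a computable bijective pairing $\langle i,j\rangle$ of natural numbers, and $\mathbb N^{\mathbb N}$ is represented by the identity. - $f$ is computable with finitely many mind changes if it has a realizer computed by a Type-2 Turing machine that is allowed to erase its output tape and to start writing anew, and that does so only finitely often on each input in the domain of the realizer. -/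

import Mathlib

namespace Weihrauch

universe u v u' v'

/-- Baire space, the set of all sequences of natural numbers. -/
abbrev Baire : Type := ℕ → ℕ

/-- The pairing `⟨p, q⟩` of Baire space: `⟨p, q⟩(2n) = p(n)` and `⟨p, q⟩(2n+1) = q(n)`. -/
def pairing (p q : Baire) : Baire := fun n => if n % 2 = 0 then p (n / 2) else q (n / 2)

/-- The `i`-th component `pᵢ` of `p = ⟨p₀, p₁, p₂, …⟩`, for the countable pairing
`⟨p₀, p₁, …⟩(⟨i, j⟩) = pᵢ(j)`, where `⟨i, j⟩ = Nat.pair i j` is a computable bijective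
pairing of numbers. -/
def component (p : Baire) (i : ℕ) : Baire := fun j => p (Nat.pair i j)

/-! ### Machines -/

/-- A Type-2 machine: a digital machine with an infinite one-way input tape, an output tape and an
internal memory. An internal state comprises the finite control together with the contents of all
work tapes; states are finite objects, coded by natural numbers. In each step the machine reads
the next input symbol and, by a computable (in the classical sense) transition function, determines
its next state, whether it erases the whole output tape in this step, and the finite, possibly
empty, word that it then writes at the end of the output tape. Symbols read early can be stored
in the internal memory. -/
structure Machine where
  State : Type
  [primcodable : Primcodable State]
  init : State
  next : State → ℕ → State × Bool × List ℕ
  computable_next : Computable₂ next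

attribute [instance] Machine.primcodable

namespace Machine

/-- The internal state after `t` steps on input `p`. -/
def state (M : Machine) (p : Baire) : ℕ → M.State
  | 0 => M.init
  | t + 1 => (M.next (M.state p t) (p t)).1

/-- In step `t` of the computation on input `p` the output tape is erased (a mind change). -/
def ErasesAt (M : Machine) (p : Baire) (t : ℕ) : Prop :=
  (M.next (M.state p t) (p t)).2.1 = true

/-- The word written in step `t` of the computation on input `p`. -/
def written (M : Machine) (p : Baire) (t : ℕ) : List ℕ :=
  (M.next (M.state p t) (p t)).2.2

open Classical in
/-- The contents of the output tape after `t` steps on input `p`. -/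
noncomputable def tape (M : Machine) (p : Baire) : ℕ → List ℕ
  | 0 => []
  | t + 1 => (if M.ErasesAt p t then [] else M.tape p t) ++ M.written p t

/-- On input `p` the machine erases its output tape only finitely often, and what it writes on the
output tape in the long run is the infinite sequence `q`. -/
def Produces (M : Machine) (p q : Baire) : Prop :=
  {t | M.ErasesAt p t}.Finite ∧
    ∀ n, ∀ᶠ t in Filter.atTop, (M.tape p t)[n]? = some (q n)

/-- The partial function `F` on Baire space is the one computed by `M`; its domain consists of the
inputs with finitely many erasures and infinite final output. -/
def Computes (M : Machine) (F : Baire →. Baire) : Prop :=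
  ∀ p q, q ∈ F p ↔ M.Produces p q

/-- An ordinary Type-2 machine, with one-way output: it never erases its output tape. -/
def OneWay (M : Machine) : Prop := ∀ p t, ¬ M.ErasesAt p t

end Machine

/-- A partial function on Baire space is computable if an ordinary Type-2 machine computes it. -/
def IsComputable (F : Baire →. Baire) : Prop := ∃ M : Machine, M.OneWay ∧ M.Computes F

/-! ### Represented spaces and multi-valued functions -/

/-- A represented space: a set with a surjective partial map `δ` from Baire space onto it. -/
class RepresentedSpace (X : Type u) where
  δ : Baire →. X
  surjective : ∀ x, ∃ p, x ∈ δ p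

open RepresentedSpace (δ)

/-- A partial multi-valued function `f :⊆ X ⇉ Y`, given by its set of values at each point; its
domain is the set of points with at least one value. -/
abbrev MultiFun (X : Type u) (Y : Type v) : Type (max u v) := X → Set Y

def MultiFun.dom {X : Type u} {Y : Type v} (f : MultiFun X Y) : Set X := {x | (f x).Nonempty}

/-- `F ⊢ f`: `δ_Y (F p) ∈ f (δ_X p)` for all `p ∈ dom (f ∘ δ_X)`. -/
def Realizes {X : Type u} {Y : Type v} [RepresentedSpace X] [RepresentedSpace Y]
    (F : Baire →. Baire) (f : MultiFun X Y) : Prop :=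
  ∀ p, ∀ x ∈ (δ p : Part X), x ∈ f.dom → ∃ q ∈ F p, ∃ y ∈ (δ q : Part Y), y ∈ f x

/-- The partial function `K ∘ ⟨id, G ∘ H⟩` on Baire space. -/
def reductionComp (K G H : Baire →. Baire) : Baire →. Baire :=
  fun p => ((H p).bind G).bind fun q => K (pairing p q)

/-- Weihrauch reducibility `f ≤_W g`. -/
def Reducible {X : Type u} {Y : Type v} {U : Type u'} {V : Type v'}
    [RepresentedSpace X] [RepresentedSpace Y] [RepresentedSpace U] [RepresentedSpace V]
    (f : MultiFun X Y) (g : MultiFun U V) : Prop :=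
  ∃ K H : Baire →. Baire, IsComputable K ∧ IsComputable H ∧
    ∀ G : Baire →. Baire, Realizes G g → Realizes (reductionComp K G H) f

/-- Weihrauch equivalence `f ≡_W g`. -/
def Equivalent {X : Type u} {Y : Type v} {U : Type u'} {V : Type v'}
    [RepresentedSpace X] [RepresentedSpace Y] [RepresentedSpace U] [RepresentedSpace V]
    (f : MultiFun X Y) (g : MultiFun U V) : Prop :=
  Reducible f g ∧ Reducible g f

/-- `f` is computable with finitely many mind changes: it has a realizer that is computed by a
machine which may erase its output tape, but for each input in the domain of the realizer does so
only finitely often. -/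
def ComputableWithFinitelyManyMindChanges {X : Type u} {Y : Type v}
    [RepresentedSpace X] [RepresentedSpace Y] (f : MultiFun X Y) : Prop :=
  ∃ (M : Machine) (F : Baire →. Baire), M.Computes F ∧ Realizes F f

/-! ### Closed choice on the natural numbers and the discrete limit -/

/-- Baire space is represented by the identity. -/
instance : RepresentedSpace Baire where
  δ := fun p => Part.some p
  surjective := fun x => ⟨x, Part.mem_some x⟩

/-- The standard representation `δ_ℕ(p) = p(0)` of the natural numbers. -/
instance : RepresentedSpace ℕ where
  δ := fun p => Part.some (p 0)
  surjective := fun n => ⟨fun _ => n, Part.mem_some n⟩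

/-- The set `{n | n + 1 ∉ range p}`, as a closed subset of the discrete space `ℕ`. -/
def negativeInfo (p : Baire) : TopologicalSpace.Closeds ℕ :=
  ⟨{n | n + 1 ∉ Set.range p}, isClosed_discrete _⟩

/-- The space `𝒜₋(ℕ)` of closed subsets of `ℕ` with the negative information representation: a
name of `A` enumerates the complement of `A`. -/
instance : RepresentedSpace (TopologicalSpace.Closeds ℕ) where
  δ := fun p => Part.some (negativeInfo p)
  surjective := fun A => by
    classical
    refine ⟨fun n => if n ∈ A then 0 else n + 1, ?_⟩
    rw [Part.mem_some_iff]
    ext n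
    change n ∈ A ↔ ¬ ∃ k, (if k ∈ A then 0 else k + 1) = n + 1
    constructor
    · rintro hn ⟨k, hk⟩
      split_ifs at hk with h
      exact h ((Nat.succ.inj hk) ▸ hn)
    · intro h
      by_contra hn
      exact h ⟨n, if_neg hn⟩

/-- Closed choice `C_ℕ :⊆ 𝒜₋(ℕ) ⇉ ℕ, A ↦ A`, whose domain consists of the non-empty sets. -/
def closedChoiceNat : MultiFun (TopologicalSpace.Closeds ℕ) ℕ := fun A => {n | n ∈ A}

/-- The discrete limit `lim_Δ :⊆ Baire → Baire, ⟨p₀, p₁, …⟩ ↦ lim pᵢ`, the limit being taken with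
respect to the discrete topology `⊥` on Baire space. -/
def discreteLimit : MultiFun Baire Baire :=
  fun p => {q | Filter.Tendsto (component p) Filter.atTop (@nhds Baire ⊥ q)}

end Weihrauch

/-! Both `closedChoiceNat` and `discreteLimit` are themselves computable with finitely many mind
changes: keep a guess, namely the least number not yet refuted by the input read so far. For closed
choice the guess converges to the minimum of the set; for the limit it converges to the least index
from which the sequence is constant. The property passes downwards along `≤_W`: run the two one-way
machines around the mind-changing one on all available prefixes, and start the output anew whenever
it has to be revised (`Reducible.computableWithFinitelyManyMindChanges`). This gives 1 → 3 and 2 →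
3.

Conversely, let `M` compute a realizer with finitely many mind changes. The time `lastErase` of its
latest erasure is a monotone bounded sequence of numbers, computable from the input. Once an upper
bound `s 0` for it is known, a one-way machine can simulate `M`, withhold all output until step `s
0`, and then copy a tape that only grows (`produces_settledTape`). So it is enough to extract upper
bounds from `g` (`ComputableWithFinitelyManyMindChanges.reducible`): closed choice picks an element
of the set of upper bounds, and the discrete limit yields the eventual value. The equivalence of the
two problems follows by applying these implications to the problems themselves. -/

namespace Weihrauch

open Filter
open RepresentedSpace (δ)

/-! ### Initial segments of sequences -/

/-- The initial segment of `p` of length `n`. -/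
def pre (p : Baire) (n : ℕ) : List ℕ := (List.range n).map p

@[simp] theorem pre_zero (p : Baire) : pre p 0 = [] := rfl

theorem pre_succ (p : Baire) (n : ℕ) : pre p (n + 1) = pre p n ++ [p n] := by
  simp [pre, List.range_succ]

@[simp] theorem length_pre (p : Baire) (n : ℕ) : (pre p n).length = n := by simp [pre]

theorem getElem?_pre {p : Baire} {i n : ℕ} (h : i < n) : (pre p n)[i]? = some (p i) := by
  simp [pre, h]

theorem getD_pre {p : Baire} {i n : ℕ} (h : i < n) : (pre p n).getD i 0 = p i := by
  simp [List.getD, getElem?_pre h]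

theorem mem_pre {p : Baire} {n a : ℕ} : a ∈ pre p n ↔ ∃ i < n, p i = a := by
  simp [pre]

theorem pre_congr {p q : Baire} {n : ℕ} (h : ∀ i < n, p i = q i) : pre p n = pre q n := by
  unfold pre
  exact List.map_congr_left fun i hi => h i (List.mem_range.1 hi)

theorem take_pre {p : Baire} {m n : ℕ} (h : m ≤ n) : (pre p n).take m = pre p m := by
  simp [pre, ← List.map_take, List.take_range, min_eq_left h]

theorem pre_prefix {p : Baire} {m n : ℕ} (h : m ≤ n) : pre p m <+: pre p n :=
  take_pre h ▸ List.take_prefix _ _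

/-- A list all of whose entries agree with `q` is an initial segment of `q`. -/
theorem eq_pre_of_getElem? {l : List ℕ} {q : Baire}
    (h : ∀ i a, l[i]? = some a → a = q i) : l = pre q l.length := by
  refine List.ext_getElem (by simp) fun i h₁ h₂ => ?_
  simpa [pre] using h i _ (List.getElem?_eq_getElem h₁)

/-- The finite words `w t` are, from some point on, growing initial segments of `q`. -/
def Approx (w : ℕ → List ℕ) (q : Baire) : Prop :=
  ∃ m : ℕ → ℕ, Monotone m ∧ Tendsto m atTop atTop ∧ ∀ᶠ t in atTop, w t = pre q (m t)

/-! ### Machines -/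

namespace Machine

variable (M : Machine)

/-- A machine produces at most one sequence on each input. -/
theorem Produces.unique {M : Machine} {p q q' : Baire} (h : M.Produces p q)
    (h' : M.Produces p q') : q = q' := by
  funext n
  obtain ⟨t, h₁, h₂⟩ := ((h.2 n).and (h'.2 n)).exists
  simpa [h₁] using h₂

/-- The partial function computed by a machine. -/
noncomputable def toFun : Baire →. Baire := fun p => ⟨∃ q, M.Produces p q, fun h => h.choose⟩

theorem computes_toFun : M.Computes M.toFun := by
  intro p q
  constructor
  · rintro ⟨h, rfl⟩
    exact h.choose_spec
  · intro h
    have hd : ∃ q, M.Produces p q := ⟨q, h⟩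
    exact ⟨hd, hd.choose_spec.unique h⟩

theorem tape_succ_of_not_erasesAt {p : Baire} {t : ℕ} (h : ¬ M.ErasesAt p t) :
    M.tape p (t + 1) = M.tape p t ++ M.written p t := by
  simp [tape, h]

theorem tape_succ_of_erasesAt {p : Baire} {t : ℕ} (h : M.ErasesAt p t) :
    M.tape p (t + 1) = M.written p t := by
  simp [tape, h]

theorem tape_prefix {p : Baire} {T : ℕ} (h : ∀ t ≥ T, ¬ M.ErasesAt p t) {s t : ℕ}
    (hs : T ≤ s) (hst : s ≤ t) : M.tape p s <+: M.tape p t := by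
  induction t, hst using Nat.le_induction with
  | base => exact List.prefix_rfl
  | succ t hst ih =>
    rw [tape_succ_of_not_erasesAt M (h t (hs.trans hst))]
    exact ih.trans (List.prefix_append _ _)

theorem exists_not_erasesAt {p : Baire} (h : {t | M.ErasesAt p t}.Finite) :
    ∃ T, ∀ t ≥ T, ¬ M.ErasesAt p t := by
  obtain ⟨T, hT⟩ := h.bddAbove
  exact ⟨T + 1, fun t ht he => by have := hT he; omega⟩

/-- After the last erasure a symbol on the tape is never removed, so it is still there at a later
time at which its position carries the final value. -/
theorem tape_eq_pre {p q : Baire} (h : ∀ n, ∀ᶠ t in atTop, (M.tape p t)[n]? = some (q n))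
    {T : ℕ} (hT : ∀ t ≥ T, ¬ M.ErasesAt p t) {t : ℕ} (ht : T ≤ t) :
    M.tape p t = pre q (M.tape p t).length := by
  refine eq_pre_of_getElem? fun i a ha => ?_
  obtain ⟨s, h₁, h₂⟩ := ((h i).and (eventually_ge_atTop t)).exists
  obtain ⟨u, hu⟩ := M.tape_prefix hT ht h₂
  have hi : i < (M.tape p t).length := (List.getElem?_eq_some_iff.1 ha).1
  rw [← hu, List.getElem?_append_left hi, ha] at h₁
  simpa using h₁

theorem tendsto_length_tape {p q : Baire}
    (h : ∀ n, ∀ᶠ t in atTop, (M.tape p t)[n]? = some (q n)) :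
    Tendsto (fun t => (M.tape p t).length) atTop atTop := by
  refine tendsto_atTop.2 fun n => (h n).mono fun t ht => ?_
  exact (List.getElem?_eq_some_iff.1 ht).1.le

theorem Produces.approx {M : Machine} {p q : Baire} (h : M.Produces p q) :
    Approx (M.tape p) q := by
  obtain ⟨T, hT⟩ := M.exists_not_erasesAt h.1
  -- The tape can shrink before `T`, so the length is frozen there to be monotone everywhere.
  refine ⟨fun t => (M.tape p (max T t)).length, fun s t hst => ?_, ?_, ?_⟩
  · exact (M.tape_prefix hT (le_max_left _ _) (max_le_max le_rfl hst)).length_le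
  · refine (tendsto_length_tape M h.2).congr' ?_
    filter_upwards [eventually_ge_atTop T] with t ht
    rw [max_eq_right ht]
  · filter_upwards [eventually_ge_atTop T] with t ht
    rw [max_eq_right ht]
    exact M.tape_eq_pre h.2 hT ht

theorem OneWay.tape_eq_pre {M : Machine} (hM : M.OneWay) {p q : Baire} (h : M.Produces p q) :
    ∃ m : ℕ → ℕ, Monotone m ∧ Tendsto m atTop atTop ∧ ∀ t, M.tape p t = pre q (m t) :=
  ⟨fun t => (M.tape p t).length,
    fun _ _ hst => (M.tape_prefix (fun t _ => hM p t) (Nat.zero_le _) hst).length_le,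
    tendsto_length_tape M h.2,
    fun t => M.tape_eq_pre h.2 (fun t _ => hM p t) (Nat.zero_le t)⟩

/-! ### The computation of a machine as a function of its input -/

/-- The number of steps up to and including the last erasure among the first `t` steps. -/
noncomputable def lastErase (p : Baire) : ℕ → ℕ
  | 0 => 0
  | t + 1 => open Classical in if M.ErasesAt p t then t + 1 else lastErase p t

theorem lastErase_le (p : Baire) (t : ℕ) : M.lastErase p t ≤ t := by
  induction t with
  | zero => rfl
  | succ t ih => unfold lastErase; split_ifs <;> omega

theorem lastErase_mono (p : Baire) : Monotone (M.lastErase p) := by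
  refine monotone_nat_of_le_succ fun t => ?_
  have := M.lastErase_le p t
  rw [lastErase]; split_ifs <;> omega

/-- An erasure in step `t` makes `lastErase` jump to `t + 1`, so any bound on `lastErase` is a time
from which the tape is safe. -/
theorem not_erasesAt_of_lastErase_le {p : Baire} {n : ℕ} (h : ∀ t, M.lastErase p t ≤ n) :
    ∀ t ≥ n, ¬ M.ErasesAt p t := by
  intro t ht he
  have := h (t + 1)
  rw [lastErase, if_pos he] at this
  omega

theorem exists_lastErase_le {p : Baire} (h : {t | M.ErasesAt p t}.Finite) :
    ∃ n, ∀ t, M.lastErase p t ≤ n := by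
  obtain ⟨T, hT⟩ := M.exists_not_erasesAt h
  refine ⟨T, fun t => ?_⟩
  rcases le_total t T with ht | ht
  · exact (M.lastErase_le p t).trans ht
  · induction t, ht using Nat.le_induction with
    | base => exact M.lastErase_le p T
    | succ t ht ih => rwa [lastErase, if_neg (hT t ht)]

/-- One step of the computation, on configurations that consist of state, output tape, number of
steps, and the value of `lastErase`. -/
def step (c : (M.State × List ℕ) × ℕ × ℕ) (a : ℕ) : (M.State × List ℕ) × ℕ × ℕ :=
  (((M.next c.1.1 a).1,
    (bif (M.next c.1.1 a).2.1 then [] else c.1.2) ++ (M.next c.1.1 a).2.2),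
    (c.2.1 + 1, bif (M.next c.1.1 a).2.1 then c.2.1 + 1 else c.2.2))

/-- The configuration reached after the input symbols in a list have been read. -/
def run (l : List ℕ) : (M.State × List ℕ) × ℕ × ℕ := l.foldl M.step ((M.init, []), (0, 0))

/-- Links the classically defined computation with the fold `run`, which is a computable function of
the input prefix. -/
theorem run_pre (p : Baire) (t : ℕ) :
    M.run (pre p t) = ((M.state p t, M.tape p t), (t, M.lastErase p t)) := by
  induction t with
  | zero => rfl
  | succ t ih =>
    rw [run, pre_succ, List.foldl_append, List.foldl_cons, List.foldl_nil, ← run, ih, step]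
    by_cases h : M.ErasesAt p t
    · simp only [lastErase, tape_succ_of_erasesAt M h, if_pos h]
      unfold ErasesAt at h
      simp [h, state, written]
    · simp only [lastErase, tape_succ_of_not_erasesAt M h, if_neg h]
      unfold ErasesAt at h
      simp [h, state, written]

end Machine

/-! ### Computability of runs, and machines given by computable actions -/

/-- Folding a computable function over a list is computable. -/
theorem computable_foldl {α σ : Type*} [Primcodable α] [Primcodable σ] {f : σ → α → σ}
    (hf : Computable₂ f) (s : σ) : Computable fun l : List α => l.foldl f s := by
  -- The fold becomes a recursion on the index with lookup `l[i]?`; indices stay below the length,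
  -- so the `none` branch is never taken.
  have h : Computable fun l : List α => Nat.rec (motive := fun _ => σ) s
      (fun i c => Option.casesOn l[i]? c fun a => f c a) l.length := by
    refine Computable.nat_rec (h := fun (l : List α) (x : ℕ × σ) =>
      (Option.casesOn l[x.1]? x.2 fun a => f x.2 a : σ)) Computable.list_length
      (Computable.const s) ?_
    refine Computable.option_casesOn (Computable.list_getElem?.comp Computable.fst
      (Computable.fst.comp Computable.snd)) (Computable.snd.comp Computable.snd) ?_
    exact hf.comp (Computable.snd.comp (Computable.snd.comp Computable.fst)) Computable.snd
  refine h.of_eq fun l => ?_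
  suffices H : ∀ n ≤ l.length, Nat.rec (motive := fun _ => σ) s
      (fun i c => Option.casesOn l[i]? c fun a => f c a) n = (l.take n).foldl f s by
    simpa using H l.length le_rfl
  intro n hn
  induction n with
  | zero => simp
  | succ n ih =>
    have hn' : n < l.length := hn
    simp only [ih hn'.le, List.getElem?_eq_getElem hn', List.take_add_one, List.foldl_append]
    simp

namespace Machine

variable (M : Machine)

theorem computable_step : Computable₂ M.step := by
  have hn : Computable fun x : ((M.State × List ℕ) × ℕ × ℕ) × ℕ => M.next x.1.1.1 x.2 :=
    M.computable_next.comp (Computable.fst.comp (Computable.fst.comp Computable.fst))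
      Computable.snd
  have hb := Computable.fst.comp (Computable.snd.comp hn)
  have ht : Computable fun x : ((M.State × List ℕ) × ℕ × ℕ) × ℕ => x.1.2.1 + 1 :=
    Computable.succ.comp (Computable.fst.comp (Computable.snd.comp Computable.fst))
  exact ((Computable.fst.comp hn).pair (Computable.list_append.comp
      (Computable.cond hb (Computable.const [])
        (Computable.snd.comp (Computable.fst.comp Computable.fst)))
      (Computable.snd.comp (Computable.snd.comp hn)))).pair
    (ht.pair (Computable.cond hb ht (Computable.snd.comp (Computable.snd.comp Computable.fst))))

theorem computable_run : Computable M.run := computable_foldl M.computable_step _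

/-- The machine that remembers the input `h` read so far and its output tape `w`, and acts
according to `c h w`. -/
def ofAction (c : List ℕ × List ℕ → Bool × List ℕ) (hc : Computable c) : Machine where
  State := List ℕ × List ℕ
  init := ([], [])
  next s a := ((s.1 ++ [a],
    (bif (c (s.1 ++ [a], s.2)).1 then [] else s.2) ++ (c (s.1 ++ [a], s.2)).2),
    c (s.1 ++ [a], s.2))
  computable_next := by
    have h₁ : Computable fun x : (List ℕ × List ℕ) × ℕ => x.1.1 ++ [x.2] :=
      Computable.list_concat.comp (Computable.fst.comp Computable.fst) Computable.snd
    have h₂ : Computable fun x : (List ℕ × List ℕ) × ℕ => c (x.1.1 ++ [x.2], x.1.2) :=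
      hc.comp (h₁.pair (Computable.snd.comp Computable.fst))
    exact (h₁.pair (Computable.list_append.comp (Computable.cond (Computable.fst.comp h₂)
      (Computable.const []) (Computable.snd.comp Computable.fst))
      (Computable.snd.comp h₂))).pair h₂

section ofAction

variable {c : List ℕ × List ℕ → Bool × List ℕ} {hc : Computable c} {p : Baire}

/-- A machine cannot read its output tape; the copy kept in the state is faithful, so actions may
depend on the tape. -/
theorem ofAction_state (t : ℕ) :
    (ofAction c hc).state p t = (pre p t, (ofAction c hc).tape p t) := by
  induction t with
  | zero => rfl
  | succ t ih =>
    by_cases h : (ofAction c hc).ErasesAt p t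
    · rw [tape_succ_of_erasesAt _ h, written, state]
      unfold ErasesAt at h
      rw [ih] at h ⊢
      simp only [ofAction] at h ⊢
      simp [h, pre_succ]
    · rw [tape_succ_of_not_erasesAt _ h, written, state]
      unfold ErasesAt at h
      rw [ih] at h ⊢
      simp only [ofAction] at h ⊢
      simp [h, pre_succ]

theorem ofAction_erasesAt (t : ℕ) : (ofAction c hc).ErasesAt p t ↔
    (c (pre p (t + 1), (ofAction c hc).tape p t)).1 = true := by
  rw [ErasesAt, ofAction_state, pre_succ]; rfl

theorem ofAction_written (t : ℕ) : (ofAction c hc).written p t =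
    (c (pre p (t + 1), (ofAction c hc).tape p t)).2 := by
  rw [written, ofAction_state, pre_succ]; rfl

end ofAction

end Machine

/-! ### Machines that follow finite approximations of their output -/

/-- The test whether a list is a prefix of another one. -/
def isPrefix (w v : List ℕ) : Bool := decide (v.take w.length = w)

theorem isPrefix_iff {w v : List ℕ} : isPrefix w v = true ↔ w <+: v := by
  simp [isPrefix, List.prefix_iff_eq_take, eq_comm]

theorem computable_isPrefix : Computable₂ isPrefix :=
  (Primrec.eq.decide.comp (Primrec.list_take.comp (Primrec.list_length.comp Primrec.fst)
    Primrec.snd) Primrec.fst).to_comp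

/-- What has to be done in order to get from the tape contents `w` to `v`; if `w` is not an
initial segment of `v`, then either erase the tape and start anew, or do nothing. -/
def action (mayErase : Bool) (w v : List ℕ) : Bool × List ℕ :=
  bif isPrefix w v then (false, v.drop w.length) else bif mayErase then (true, v) else (false, [])

theorem computable_action (b : Bool) : Computable₂ (action b) := by
  refine Computable.cond computable_isPrefix ((Computable.const false).pair
    (Primrec.list_drop.comp (Primrec.list_length.comp Primrec.fst) Primrec.snd).to_comp) ?_
  exact Computable.cond (Computable.const b) ((Computable.const true).pair Computable.snd)
    (Computable.const _)

namespace Machine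

variable {g : List ℕ → List ℕ}

/-- The machine that tries to have written `g h` whenever it has read `h`. -/
def ofApprox (mayErase : Bool) (g : List ℕ → List ℕ) (hg : Computable g) : Machine :=
  ofAction (fun x => action mayErase x.2 (g x.1))
    ((computable_action mayErase).comp Computable.snd (hg.comp Computable.fst))

theorem oneWay_ofApprox (hg : Computable g) : (ofApprox false g hg).OneWay := by
  intro p t h
  rw [ofApprox, ofAction_erasesAt] at h
  revert h
  simp only [action, cond_false]
  cases isPrefix _ _ <;> simp

theorem ofApprox_tape_succ {b : Bool} (hg : Computable g) {p : Baire} {t : ℕ}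
    (h : (ofApprox b g hg).tape p t <+: g (pre p (t + 1))) :
    ¬ (ofApprox b g hg).ErasesAt p t ∧ (ofApprox b g hg).tape p (t + 1) = g (pre p (t + 1)) := by
  have h' := isPrefix_iff.2 h
  have he : ¬ (ofApprox b g hg).ErasesAt p t := by
    rw [ofApprox, ofAction_erasesAt, ← ofApprox.eq_1 b g hg]
    simp [action, h']
  refine ⟨he, ?_⟩
  rw [tape_succ_of_not_erasesAt _ he, ofApprox, ofAction_written, ← ofApprox.eq_1 b g hg]
  obtain ⟨u, hu⟩ := h
  simp only [action, h', cond_true]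
  rw [← hu]; simp

/-- Either the missing part is appended, or the tape is erased and the target rewritten. The shift
to `t + 1` is needed because the tape starts empty whatever `g []` is. -/
theorem ofApprox_true_tape (hg : Computable g) (p : Baire) (t : ℕ) :
    (ofApprox true g hg).tape p (t + 1) = g (pre p (t + 1)) := by
  by_cases h : (ofApprox true g hg).tape p t <+: g (pre p (t + 1))
  · exact (ofApprox_tape_succ hg h).2
  · have h' := isPrefix_iff.not.2 h
    have he : (ofApprox true g hg).ErasesAt p t := by
      rw [ofApprox, ofAction_erasesAt, ← ofApprox.eq_1 true g hg]
      simp [action, h']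
    rw [tape_succ_of_erasesAt _ he, ofApprox, ofAction_written, ← ofApprox.eq_1 true g hg]
    simp [action, h']

/-- If the targets only grow, each is reached from the previous one by appending, so the right to
erase is not needed. -/
theorem ofApprox_false_tape (hg : Computable g) {p : Baire}
    (h : ∀ t, g (pre p t) <+: g (pre p (t + 1))) (t : ℕ) :
    (ofApprox false g hg).tape p (t + 1) = g (pre p (t + 1)) := by
  induction t with
  | zero => exact (ofApprox_tape_succ hg (by simp [tape])).2
  | succ t ih => exact (ofApprox_tape_succ hg (ih ▸ h (t + 1))).2

end Machine

theorem Approx.getElem? {w : ℕ → List ℕ} {q : Baire} (h : Approx w q) (n : ℕ) :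
    ∀ᶠ t in atTop, (w t)[n]? = some (q n) := by
  obtain ⟨m, -, hm, hw⟩ := h
  filter_upwards [hw, hm.eventually_gt_atTop n] with t h₁ h₂
  rw [h₁, getElem?_pre h₂]

/-- A machine that may erase its output tape produces what a computable function of the input
approximates. -/
theorem Machine.produces_ofApprox_true {g : List ℕ → List ℕ} (hg : Computable g) {p q : Baire}
    (h : Approx (fun t => g (pre p t)) q) : (ofApprox true g hg).Produces p q := by
  constructor
  · obtain ⟨m, hm, -, hw⟩ := h
    obtain ⟨T, hT⟩ := eventually_atTop.1 hw
    -- From step `T + 1` on, both the tape and the next target are initial segments of `q` of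
    -- nondecreasing length, so no erasure is triggered.
    refine (Set.finite_Iio (T + 1)).subset fun t ht => ?_
    by_contra hlt
    obtain ⟨s, rfl⟩ : ∃ s, t = s + 1 :=
      ⟨t - 1, by simp only [Set.mem_Iio, not_lt] at hlt; omega⟩
    have hs : T ≤ s := by simpa using hlt
    refine (ofApprox_tape_succ hg (p := p) (t := s + 1) ?_).1 ht
    have h₁ := hT (s + 1) (by omega)
    have h₂ := hT (s + 1 + 1) (by omega)
    beta_reduce at h₁ h₂
    rw [ofApprox_true_tape, h₁, h₂]
    exact pre_prefix (hm (by omega))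
  · intro n
    filter_upwards [h.getElem? n, eventually_gt_atTop 0] with t ht h0
    obtain ⟨s, rfl⟩ := Nat.exists_eq_succ_of_ne_zero h0.ne'
    rwa [Nat.succ_eq_add_one, ofApprox_true_tape]

theorem Machine.produces_ofApprox_false {g : List ℕ → List ℕ} (hg : Computable g) {p q : Baire}
    (h : Approx (fun t => g (pre p t)) q) (hmono : ∀ t, g (pre p t) <+: g (pre p (t + 1))) :
    (ofApprox false g hg).Produces p q := by
  refine ⟨Set.finite_empty.subset fun t ht => oneWay_ofApprox hg p t ht, fun n => ?_⟩
  filter_upwards [h.getElem? n, eventually_gt_atTop 0] with t ht h0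
  obtain ⟨s, rfl⟩ := Nat.exists_eq_succ_of_ne_zero h0.ne'
  rwa [Nat.succ_eq_add_one, ofApprox_false_tape hg hmono]

/-- Functions each of whose values depends computably on an initial segment of the input. -/
theorem isComputable_of_prefix {φ : List ℕ → ℕ} (hφ : Computable φ) :
    IsComputable fun p => Part.some fun t => φ (pre p (t + 1)) := by
  have hc : Computable fun x : List ℕ × List ℕ => (false, [φ x.1]) :=
    (Computable.const false).pair
      (Computable.list_cons.comp (hφ.comp Computable.fst) (Computable.const []))
  have how : (Machine.ofAction _ hc).OneWay := fun p t h => by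
    simp [Machine.ofAction_erasesAt] at h
  refine ⟨Machine.ofAction _ hc, how, ?_⟩
  have htape : ∀ p t, (Machine.ofAction _ hc).tape p t = pre (fun t => φ (pre p (t + 1))) t := by
    intro p t
    induction t with
    | zero => rfl
    | succ t ih =>
      rw [Machine.tape_succ_of_not_erasesAt _ (how p t), ih, pre_succ, Machine.ofAction_written]
  have hprod : ∀ p, (Machine.ofAction _ hc).Produces p fun t => φ (pre p (t + 1)) := by
    refine fun p => ⟨Set.finite_empty.subset fun t ht => how p t ht, fun n => ?_⟩
    filter_upwards [eventually_gt_atTop n] with t ht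
    rw [htape, getElem?_pre ht]
  intro p q
  rw [Part.mem_some_iff]
  exact ⟨fun h => h ▸ hprod p, fun h => h.unique (hprod p)⟩

universe u v u' v'

variable {X : Type u} {Y : Type v} {U : Type u'} {V : Type v'}
  [RepresentedSpace X] [RepresentedSpace Y] [RepresentedSpace U] [RepresentedSpace V]

/-! ### Downward closure of computability with finitely many mind changes -/

/-- The initial segment of `⟨p, q⟩` determined by initial segments of `p` and `q`. -/
def pairPrefix (l s : List ℕ) : List ℕ :=
  (List.range (2 * min l.length s.length)).map fun n =>
    bif decide (n % 2 = 0) then l.getD (n / 2) 0 else s.getD (n / 2) 0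

theorem pairPrefix_pre (p q : Baire) (m n : ℕ) :
    pairPrefix (pre p m) (pre q n) = pre (pairing p q) (2 * min m n) := by
  simp only [pairPrefix, length_pre]
  refine pre_congr fun i hi => ?_
  rw [getD_pre (by omega), getD_pre (by omega), pairing]
  simp only [Bool.cond_decide]

theorem primrec_pairPrefix : Primrec₂ pairPrefix := by
  refine Primrec.list_map (Primrec.list_range.comp (Primrec.nat_mul.comp (Primrec.const 2)
    (Primrec.nat_min.comp (Primrec.list_length.comp Primrec.fst)
      (Primrec.list_length.comp Primrec.snd)))) ?_
  have hd : Primrec fun x : (List ℕ × List ℕ) × ℕ => x.2 / 2 :=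
    Primrec.nat_div.comp Primrec.snd (Primrec.const 2)
  exact Primrec.cond (Primrec.eq.decide.comp
      (Primrec.nat_mod.comp Primrec.snd (Primrec.const 2)) (Primrec.const 0))
    ((Primrec.list_getD 0).comp (Primrec.fst.comp Primrec.fst) hd)
    ((Primrec.list_getD 0).comp (Primrec.snd.comp Primrec.fst) hd)

/-- The output after `K`, `G` and `H` have been run on the available initial segments. -/
def compApprox (K G H : Machine) (l : List ℕ) : List ℕ :=
  (K.run (pairPrefix l (G.run (H.run l).1.2).1.2)).1.2

theorem Machine.computable_tape (M : Machine) : Computable fun l => (M.run l).1.2 :=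
  Computable.snd.comp (Computable.fst.comp M.computable_run)

theorem computable_compApprox (K G H : Machine) : Computable (compApprox K G H) :=
  K.computable_tape.comp (primrec_pairPrefix.to_comp.comp Computable.id
    (G.computable_tape.comp H.computable_tape))

/-- Only `G` can revise its output. Since `H` never does, `G` sees growing prefixes of `r`; once `G`
has settled, `K` sees growing prefixes of the true pair and its output is final. -/
theorem approx_compApprox {K G H : Machine} (hK : K.OneWay) (hH : H.OneWay) {p r s q : Baire}
    (hr : H.Produces p r) (hs : G.Produces r s) (hq : K.Produces (pairing p s) q) :
    Approx (fun t => compApprox K G H (pre p t)) q := by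
  obtain ⟨mH, hH₁, hH₂, hH₃⟩ := hH.tape_eq_pre hr
  obtain ⟨mK, hK₁, hK₂, hK₃⟩ := hK.tape_eq_pre hq
  obtain ⟨mG, hG₁, hG₂, hG₃⟩ := hs.approx
  refine ⟨fun t => mK (2 * min t (mG (mH t))), fun a b hab => ?_, ?_, ?_⟩
  · exact hK₁ (Nat.mul_le_mul_left _ (min_le_min hab (hG₁ (hH₁ hab))))
  · refine hK₂.comp (tendsto_atTop_mono (fun t => Nat.le_mul_of_pos_left _ two_pos) ?_)
    exact tendsto_atTop.2 fun n => ((eventually_ge_atTop n).and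
      ((hG₂.comp hH₂).eventually_ge_atTop n)).mono fun t h => le_min h.1 h.2
  · filter_upwards [hH₂.eventually hG₃] with t ht
    simp only [compApprox, Machine.run_pre, hH₃, ht, pairPrefix_pre, hK₃]

/-- Computability with finitely many mind changes is inherited downwards by `≤_W`. -/
theorem Reducible.computableWithFinitelyManyMindChanges {f : MultiFun X Y} {g : MultiFun U V}
    (h : Reducible f g) (hg : ComputableWithFinitelyManyMindChanges g) :
    ComputableWithFinitelyManyMindChanges f := by
  obtain ⟨K, H, ⟨MK, hMK, hK⟩, ⟨MH, hMH, hH⟩, hred⟩ := h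
  obtain ⟨MG, G, hG, hGg⟩ := hg
  have hc := computable_compApprox MK MG MH
  refine ⟨_, _, (Machine.ofApprox true _ hc).computes_toFun, fun p x hx hxf => ?_⟩
  obtain ⟨q, hq, hy⟩ := hred G hGg p x hx hxf
  obtain ⟨s, hs, hq⟩ := Part.mem_bind_iff.1 hq
  obtain ⟨r, hr, hs⟩ := Part.mem_bind_iff.1 hs
  exact ⟨q, (Machine.computes_toFun _ _ _).2 (Machine.produces_ofApprox_true hc
    (approx_compApprox hMK hMH ((hH _ _).1 hr) ((hG _ _).1 hs) ((hK _ _).1 hq))), hy⟩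

/-! ### Reductions from functions that are computable with finitely many mind changes -/

/-- The initial segment of `p` determined by an initial segment of `⟨p, q⟩`. -/
def evens (l : List ℕ) : List ℕ := (List.range (l.length / 2)).map fun i => l.getD (2 * i) 0

theorem evens_pre (p q : Baire) (t : ℕ) : evens (pre (pairing p q) t) = pre p (t / 2) := by
  simp only [evens, length_pre]
  refine pre_congr fun i hi => ?_
  rw [getD_pre (by omega), pairing]
  simp

theorem primrec_evens : Primrec evens :=
  Primrec.list_map (Primrec.list_range.comp (Primrec.nat_div.comp Primrec.list_length
    (Primrec.const 2))) ((Primrec.list_getD 0).comp Primrec.fst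
      (Primrec.nat_mul.comp (Primrec.const 2) Primrec.snd))

/-- On an initial segment of `⟨p, q⟩`, the output tape of `M` on input `p`, provided that at least
`q 0` steps have been made, the last erasure being among the first `q 0` steps. -/
def settledTape (M : Machine) (l : List ℕ) : List ℕ :=
  -- `q 0` is entry 1 of `⟨p, q⟩`, so it is known only once two symbols are read. The `max` with 1
  -- keeps the default 0 from being mistaken for it.
  bif decide (max (l.getD 1 0) 1 ≤ (evens l).length) && decide ((M.run (evens l)).2.2 ≤ l.getD 1 0)
  then (M.run (evens l)).1.2 else []

theorem computable_settledTape (M : Machine) : Computable (settledTape M) := by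
  have h₁ : Primrec fun l : List ℕ => l.getD 1 0 :=
    (Primrec.list_getD 0).comp Primrec.id (Primrec.const 1)
  have h₂ := M.computable_run.comp primrec_evens.to_comp
  have hle : Computable₂ fun a b : ℕ => decide (a ≤ b) := Primrec.nat_le.decide.to_comp
  exact Computable.cond (Primrec.and.to_comp.comp
      (hle.comp (Primrec.nat_max.comp h₁ (Primrec.const 1)).to_comp
        (Primrec.list_length.comp primrec_evens).to_comp)
      (hle.comp (Computable.snd.comp (Computable.snd.comp h₂)) h₁.to_comp))
    (Computable.snd.comp (Computable.fst.comp h₂)) (Computable.const [])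

theorem settledTape_pre {M : Machine} {p s : Baire} (hs : ∀ t, M.lastErase p t ≤ s 0) (t : ℕ) :
    settledTape M (pre (pairing p s) t) =
      if max (s 0) 1 ≤ t / 2 then M.tape p (t / 2) else [] := by
  simp only [settledTape, evens_pre, M.run_pre, length_pre]
  by_cases ht : 2 ≤ t
  · rw [getD_pre (by omega)]
    simp [pairing, hs, Bool.cond_eq_ite]
  · have h0 : t / 2 = 0 := by omega
    simp [h0]

/-- No erasure occurs from step `s 0` on, so the withheld tape jumps once from empty to the current
contents and then only grows; one-way output suffices. -/
theorem produces_settledTape {M : Machine} {p s q : Baire} (hs : ∀ t, M.lastErase p t ≤ s 0)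
    (hq : M.Produces p q) :
    (Machine.ofApprox false _ (computable_settledTape M)).Produces (pairing p s) q := by
  have hE := M.not_erasesAt_of_lastErase_le hs
  refine Machine.produces_ofApprox_false _ ?_ fun t => ?_
  · obtain ⟨m, hm₁, hm₂, hm₃⟩ := hq.approx
    have hdiv : Tendsto (fun t : ℕ => t / 2) atTop atTop :=
      tendsto_atTop.2 fun n => (eventually_ge_atTop (2 * n)).mono fun t ht => by omega
    refine ⟨fun t => m (t / 2), fun a b hab => hm₁ (Nat.div_le_div_right hab),
      hm₂.comp hdiv, ?_⟩
    filter_upwards [hdiv.eventually hm₃, hdiv.eventually_ge_atTop (max (s 0) 1)] with t h₁ h₂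
    rw [settledTape_pre hs, if_pos h₂, h₁]
  · rw [settledTape_pre hs, settledTape_pre hs]
    split_ifs with h₁ h₂
    · exact M.tape_prefix hE ((le_max_left _ _).trans h₁) (Nat.div_le_div_right t.le_succ)
    · exact absurd (h₁.trans (Nat.div_le_div_right t.le_succ)) h₂
    · exact List.nil_prefix
    · exact List.nil_prefix

/-- A function that is computable with finitely many mind changes is reducible to `g` if upper
bounds of monotone bounded sequences can be obtained, in a uniform way, as values of `g`. -/
theorem ComputableWithFinitelyManyMindChanges.reducible {f : MultiFun X Y} {g : MultiFun U V}
    (hf : ComputableWithFinitelyManyMindChanges f) {c : ℕ → ℕ → ℕ} (hc : Computable₂ c)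
    (hg : ∀ e : ℕ → ℕ, Monotone e → BddAbove (Set.range e) →
      ∃ u ∈ (δ fun t => c t (e t.unpair.1) : Part U), u ∈ g.dom ∧
        ∀ s, ∀ v ∈ (δ s : Part V), v ∈ g u → ∀ i, e i ≤ s 0) :
    Reducible f g := by
  obtain ⟨M, F, hM, hF⟩ := hf
  -- Entry `t` of the name passed to `g` is written after `t + 1` symbols are read, hence `length -
  -- 1`. It needs only the first `t.unpair.1 ≤ t` of them, which determine the value of `lastErase`
  -- at that time.
  have hφ : Computable fun h : List ℕ =>
      c (h.length - 1) (M.run (h.take (h.length - 1).unpair.1)).2.2 := by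
    have hl : Primrec fun h : List ℕ => h.length - 1 := Primrec.pred.comp Primrec.list_length
    exact hc.comp hl.to_comp (Computable.snd.comp (Computable.snd.comp (M.computable_run.comp
      (Primrec.list_take.comp (Primrec.fst.comp (Primrec.unpair.comp hl)) Primrec.id).to_comp)))
  refine ⟨_, _, ⟨_, Machine.oneWay_ofApprox (computable_settledTape M),
    Machine.computes_toFun _⟩, isComputable_of_prefix hφ, fun G hG p x hx hxf => ?_⟩
  obtain ⟨q, hq, hy⟩ := hF p x hx hxf
  have hp := (hM _ _).1 hq
  obtain ⟨n, hn⟩ := M.exists_lastErase_le hp.1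
  obtain ⟨u, hu, hug, hbound⟩ := hg (M.lastErase p) (M.lastErase_mono p)
    ⟨n, Set.forall_mem_range.2 hn⟩
  obtain ⟨s, hs, v, hv, hvu⟩ := hG _ u hu hug
  refine ⟨q, Part.mem_bind_iff.2 ?_, hy⟩
  refine ⟨s, Part.mem_bind_iff.2 ⟨_, Part.mem_some _, ?_⟩, (Machine.computes_toFun _ _ _).2
    (produces_settledTape (hbound s v hv hvu) hp)⟩
  convert hs using 3 with t
  rw [length_pre, Nat.add_sub_cancel, take_pre (t.unpair_left_le.trans t.le_succ), M.run_pre]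

/-- Functions that are computable with finitely many mind changes are reducible to closed choice
on the natural numbers. -/
theorem ComputableWithFinitelyManyMindChanges.reducible_closedChoiceNat {f : MultiFun X Y}
    (hf : ComputableWithFinitelyManyMindChanges f) : Reducible f closedChoiceNat := by
  -- Position `t = ⟨i, k⟩` removes `k` when `k < e i`, and otherwise writes the neutral symbol 0.
  -- What remains is the set of upper bounds of `e`, non-empty because `e` is bounded.
  have hc : Computable₂ fun t n : ℕ => bif decide (t.unpair.2 < n) then t.unpair.2 + 1 else 0 := by
    have h : Primrec fun x : ℕ × ℕ => x.1.unpair.2 :=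
      Primrec.snd.comp (Primrec.unpair.comp Primrec.fst)
    exact (Primrec.cond (Primrec.nat_lt.decide.comp h Primrec.snd) (Primrec.succ.comp h)
      (Primrec.const 0)).to_comp
  refine hf.reducible hc fun e _ ⟨n, hn⟩ => ⟨_, Part.mem_some _, ⟨n, ?_⟩, ?_⟩
  · rintro ⟨t, ht⟩
    have := hn ⟨t.unpair.1, rfl⟩
    by_cases h : t.unpair.2 < e t.unpair.1
    · simp [h] at ht; omega
    · simp [h] at ht
  · intro s v hv hvu i
    obtain rfl := Part.mem_some_iff.1 hv
    by_contra hlt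
    exact hvu ⟨Nat.pair i (s 0), by simpa [Bool.cond_eq_ite] using hlt⟩

theorem mem_discreteLimit_iff {p q : Baire} :
    q ∈ discreteLimit p ↔ ∀ᶠ i in atTop, component p i = q := by
  change Tendsto _ _ (@nhds Baire ⊥ q) ↔ _
  rw [@nhds_discrete Baire ⊥ (@DiscreteTopology.mk _ ⊥ rfl), tendsto_pure]

/-- Functions that are computable with finitely many mind changes are reducible to the discrete
limit. -/
theorem ComputableWithFinitelyManyMindChanges.reducible_discreteLimit {f : MultiFun X Y}
    (hf : ComputableWithFinitelyManyMindChanges f) : Reducible f discreteLimit := by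
  -- The `i`-th component is the constant sequence `e i`. A bounded monotone sequence of numbers is
  -- eventually constant, and its limit is its maximum.
  refine hf.reducible (c := fun _ n => n) Computable.snd fun e he hb => ?_
  have hlim : ∀ i, component (fun t => e t.unpair.1) i = fun _ => e i := fun i => by
    funext j; simp [component]
  refine ⟨_, Part.mem_some _, ?_, ?_⟩
  · obtain ⟨n, hn⟩ := hb
    obtain ⟨T, hT⟩ : ∃ T, ∀ i, e i ≤ e T := by
      obtain ⟨_, ⟨T, rfl⟩, hT⟩ := (Set.finite_Iic n).subset hn |>.exists_maximal ⟨_, 0, rfl⟩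
      exact ⟨T, fun i => (le_total (e i) (e T)).elim id fun h => hT ⟨i, rfl⟩ h⟩
    refine ⟨fun _ => e T, mem_discreteLimit_iff.2 ?_⟩
    filter_upwards [eventually_ge_atTop T] with i hi
    rw [hlim, (hT i).antisymm (he hi)]
  · intro s v hv hvu i
    obtain rfl : v = s := Part.mem_some_iff.1 hv
    obtain ⟨j, h₁, h₂⟩ := ((mem_discreteLimit_iff.1 hvu).and (eventually_ge_atTop i)).exists
    rw [hlim] at h₁
    exact (he h₂).trans_eq (congrFun h₁ 0)

/-! ### Closed choice and the discrete limit are computable with finitely many mind changes -/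

/-- The least number that is not refuted by an initial segment of the input. -/
def guess (B : List ℕ → ℕ → Prop) [DecidableRel B] (l : List ℕ) : ℕ :=
  Nat.findGreatest (fun n => ∀ x < n, B l x) l.length

section guess

variable {B : List ℕ → ℕ → Prop} [DecidableRel B]

theorem primrec_guess (hB : PrimrecRel B) : Primrec (guess B) := by
  refine Primrec.nat_findGreatest Primrec.list_length ?_
  have h : PrimrecRel fun x l => B l x := hB.swap
  exact (h.forall_mem_list.comp (Primrec.list_range.comp Primrec.snd) Primrec.fst).of_eq
    (by simp)

/-- The never refuted `a` blocks every larger guess, while the finitely many smaller numbers have a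
common time of refutation. The cap by the length of the prefix disappears once `a` symbols are read.
-/
theorem guess_pre_eventually {p : Baire} {a : ℕ} (ha : ∀ t, ¬ B (pre p t) a)
    (hlt : ∀ x < a, ∀ᶠ t in atTop, B (pre p t) x) :
    ∀ᶠ t in atTop, guess B (pre p t) = a := by
  have h : ∀ᶠ t in atTop, ∀ x < a, B (pre p t) x :=
    (eventually_all_finite (Set.finite_Iio a)).2 hlt
  filter_upwards [h, eventually_ge_atTop a] with t h₁ h₂
  refine (Nat.findGreatest_eq_iff).2 ⟨by simpa using h₂, fun _ => h₁, fun n hn _ hall => ?_⟩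
  exact ha t (hall a hn)

end guess

theorem computableWithFinitelyManyMindChanges_of_approx {f : MultiFun X Y} {g : List ℕ → List ℕ}
    (hg : Computable g) (h : ∀ p, ∀ x ∈ (δ p : Part X), x ∈ f.dom →
      ∃ q, Approx (fun t => g (pre p t)) q ∧ ∃ y ∈ (δ q : Part Y), y ∈ f x) :
    ComputableWithFinitelyManyMindChanges f := by
  refine ⟨_, _, (Machine.ofApprox true g hg).computes_toFun, fun p x hx hxf => ?_⟩
  obtain ⟨q, hq, hy⟩ := h p x hx hxf
  exact ⟨q, (Machine.computes_toFun _ _ _).2 (Machine.produces_ofApprox_true hg hq), hy⟩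

theorem computableWithFinitelyManyMindChanges_closedChoiceNat :
    ComputableWithFinitelyManyMindChanges closedChoiceNat := by
  have hB : PrimrecRel fun (l : List ℕ) (x : ℕ) => x + 1 ∈ l :=
    ((Primrec.eq (α := ℕ)).exists_mem_list.comp Primrec.fst
      (Primrec.succ.comp Primrec.snd)).of_eq (by simp)
  -- A number is named by entry 0 alone; the guess is repeated so that the output becomes infinite.
  have hg : Primrec fun l : List ℕ =>
      (List.range l.length).map fun _ => guess (fun l x => x + 1 ∈ l) l :=
    Primrec.list_map (Primrec.list_range.comp Primrec.list_length)
      ((primrec_guess hB).comp Primrec.fst)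
  refine computableWithFinitelyManyMindChanges_of_approx hg.to_comp fun p A hA hAd => ?_
  obtain rfl := Part.mem_some_iff.1 hA
  have hne : ∃ n, n + 1 ∉ Set.range p := hAd
  classical
  refine ⟨fun _ => Nat.find hne, ⟨id, monotone_id, tendsto_id, ?_⟩, _, Part.mem_some _,
    Nat.find_spec hne⟩
  have hguess := guess_pre_eventually (B := fun l x => x + 1 ∈ l) (p := p) (a := Nat.find hne)
    (fun t ht => Nat.find_spec hne ((mem_pre.1 ht).imp fun i hi => hi.2)) fun x hx => by
      obtain ⟨i, hi⟩ := not_not.1 (Nat.find_min hne hx)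
      filter_upwards [eventually_gt_atTop i] with t ht using mem_pre.2 ⟨i, ht, hi⟩
  filter_upwards [hguess] with t ht
  simp only [ht, length_pre]
  rfl

/-- An initial segment of `⟨p₀, p₁, …⟩` shows that not all of `pₓ, pₓ₊₁, …` are equal. -/
def RefutesLimit (l : List ℕ) (x : ℕ) : Prop :=
  ∃ m < l.length, x ≤ m.unpair.1 ∧ l.getD (Nat.pair x m.unpair.2) 0 ≠ l.getD m 0

instance : DecidableRel RefutesLimit := fun l _ =>
  inferInstanceAs (Decidable (∃ m < l.length, _))

theorem primrecRel_refutesLimit : PrimrecRel RefutesLimit := by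
  have hR : PrimrecRel fun (m : ℕ) (y : List ℕ × ℕ) =>
      y.2 ≤ m.unpair.1 ∧ y.1.getD (Nat.pair y.2 m.unpair.2) 0 ≠ y.1.getD m 0 := by
    have hm : Primrec fun z : ℕ × List ℕ × ℕ => z.1.unpair := Primrec.unpair.comp Primrec.fst
    have hl : Primrec fun z : ℕ × List ℕ × ℕ => z.2.1 := Primrec.fst.comp Primrec.snd
    have hx : Primrec fun z : ℕ × List ℕ × ℕ => z.2.2 := Primrec.snd.comp Primrec.snd
    refine PrimrecPred.and (Primrec.nat_le.comp hx (Primrec.fst.comp hm)) (PrimrecPred.not ?_)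
    exact Primrec.eq.comp ((Primrec.list_getD 0).comp hl
        (Primrec₂.natPair.comp hx (Primrec.snd.comp hm)))
      ((Primrec.list_getD 0).comp hl Primrec.fst)
  exact (hR.exists_mem_list.comp (Primrec.list_range.comp (Primrec.list_length.comp Primrec.fst))
    Primrec.id).of_eq (by simp [RefutesLimit])

theorem refutesLimit_pre {p : Baire} {t x : ℕ} : RefutesLimit (pre p t) x ↔
    ∃ i ≥ x, ∃ j, Nat.pair i j < t ∧ component p x j ≠ component p i j := by
  -- Pairing is monotone in its left argument, so the entry compared with in `pₓ` has been read too
  -- and no default value enters.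
  have key : ∀ i j, x ≤ i → Nat.pair i j < t → Nat.pair x j < t := fun i j hi ht =>
    hi.eq_or_lt.elim (fun h => h ▸ ht) fun h => (Nat.pair_lt_pair_left j h).trans ht
  simp only [RefutesLimit, length_pre, component]
  constructor
  · rintro ⟨m, hm, hx, hne⟩
    have hm' : Nat.pair m.unpair.1 m.unpair.2 < t := by rwa [Nat.pair_unpair]
    refine ⟨m.unpair.1, hx, m.unpair.2, hm', ?_⟩
    rwa [getD_pre hm, getD_pre (key _ _ hx hm'), ← Nat.pair_unpair m, Nat.unpair_pair] at hne
  · rintro ⟨i, hi, j, ht, hne⟩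
    refine ⟨Nat.pair i j, ht, by simpa using hi, ?_⟩
    rwa [Nat.unpair_pair, getD_pre ht, getD_pre (key _ _ hi ht)]

theorem computableWithFinitelyManyMindChanges_discreteLimit :
    ComputableWithFinitelyManyMindChanges discreteLimit := by
  -- Since `Nat.pair a j < (max a j + 1) ^ 2`, a prefix of length `t` contains the first `√t`
  -- entries of `pₐ` as soon as `a < √t`.
  have hg : Primrec fun l : List ℕ => (List.range l.length.sqrt).map fun j =>
      l.getD (Nat.pair (guess RefutesLimit l) j) 0 :=
    Primrec.list_map (Primrec.list_range.comp (Primrec.nat_sqrt.comp Primrec.list_length))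
      ((Primrec.list_getD 0).comp Primrec.fst (Primrec₂.natPair.comp
        ((primrec_guess primrecRel_refutesLimit).comp Primrec.fst) Primrec.snd))
  refine computableWithFinitelyManyMindChanges_of_approx hg.to_comp fun p x hx => ?_
  obtain rfl : p = x := (Part.mem_some_iff.1 hx).symm
  rintro ⟨q, hq⟩
  refine ⟨q, ?_, q, Part.mem_some _, hq⟩
  obtain ⟨N, hN⟩ := eventually_atTop.1 (mem_discreteLimit_iff.1 hq)
  have hex : ∃ a, ∀ i ≥ a, component p a = component p i :=
    ⟨N, fun i hi => (hN N le_rfl).trans (hN i hi).symm⟩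
  classical
  -- The guesses converge to the least index of a constant tail: every smaller index is refuted by a
  -- single disagreeing entry, which a finite prefix reveals.
  set a := Nat.find hex with ha
  have hspec : ∀ i ≥ a, component p a = component p i := Nat.find_spec hex
  have hqa : component p a = q :=
    (hspec _ (le_max_left a N)).trans (hN _ (le_max_right a N))
  have hguess : ∀ᶠ t in atTop, guess RefutesLimit (pre p t) = a := by
    refine guess_pre_eventually (fun t ht => ?_) fun x hx => ?_
    · obtain ⟨i, hi, j, -, hne⟩ := refutesLimit_pre.1 ht
      exact hne (congrFun (hspec i hi) j)
    · have := Nat.find_min hex hx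
      push Not at this
      obtain ⟨i, hi, hne⟩ := this
      obtain ⟨j, hj⟩ := Function.ne_iff.1 hne
      filter_upwards [eventually_gt_atTop (Nat.pair i j)] with t ht
      exact refutesLimit_pre.2 ⟨i, hi, j, ht, hj⟩
  have hsqrt : Tendsto Nat.sqrt atTop atTop := tendsto_atTop.2 fun n =>
    (eventually_ge_atTop (n * n)).mono fun t ht => Nat.le_sqrt.2 ht
  refine ⟨Nat.sqrt, fun _ _ h => Nat.sqrt_le_sqrt h, hsqrt, ?_⟩
  filter_upwards [hguess, hsqrt.eventually_gt_atTop a] with t h₁ h₂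
  rw [h₁, length_pre]
  refine pre_congr fun j hj => ?_
  have hlt : Nat.pair a j < t := by
    refine (Nat.pair_lt_max_add_one_sq a j).trans_le (le_trans ?_ (Nat.sqrt_le' t))
    exact Nat.pow_le_pow_left (max_lt h₂ hj) 2
  rw [getD_pre hlt, ← hqa, component]

end Weihrauch

/-! ### The equivalence theorem -/

theorem mainTheorem5 :
    (∀ {X : Type*} {Y : Type*} [Weihrauch.RepresentedSpace X] [Weihrauch.RepresentedSpace Y]
      (f : Weihrauch.MultiFun X Y),
      List.TFAE
        [Weihrauch.Reducible f Weihrauch.closedChoiceNat,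
         Weihrauch.Reducible f Weihrauch.discreteLimit,
         Weihrauch.ComputableWithFinitelyManyMindChanges f]) ∧
    Weihrauch.Equivalent Weihrauch.discreteLimit Weihrauch.closedChoiceNat := by
  have hC := Weihrauch.computableWithFinitelyManyMindChanges_closedChoiceNat
  have hL := Weihrauch.computableWithFinitelyManyMindChanges_discreteLimit
  refine ⟨fun f => ?_, hL.reducible_closedChoiceNat, hC.reducible_discreteLimit⟩
  tfae_have 1 → 3 := fun h => h.computableWithFinitelyManyMindChanges hC
  tfae_have 2 → 3 := fun h => h.computableWithFinitelyManyMindChanges hL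
  tfae_have 3 → 1 := fun h => h.reducible_closedChoiceNat
  tfae_have 3 → 2 := fun h => h.reducible_discreteLimit
  tfae_finish
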